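/- **Setting.** Fix a buffer size $B\in\mathbb N$, a serving rate $\alpha>0$, a synchronization delay $\Delta t>0$, a discount factor $\gamma\in[0,1)$ and a degree bound $d\in\mathbb N$; put $\mathcal Z=\{0,\dots,B\}$. Let $(m_t)_{t\in\mathbb N}$ be a Markov chain on a finite set $M$ and let $\lambda(t)=\lambda_{m_t}\ge 0$ be the arrival rate per agent in epoch $t$ (Markov modulated arrivals). All graphs are simple and undirected, and every node has at most $d$ neighbours. *Dynamics.* On a graph with node set $\mathcal N$, with initial queue fillings $\mathbf z\in\mathcal Z^{\mathcal N}$ and decision rules $\zeta_t\colon\mathcal Z\to[0,1]$, in each epoch $t$ every agent $i$ independently draws $a_i(t)\in\{0,1\}$ with $\mathbb P(a_i(t)=1)=\zeta_t(z_i(t))$ (offload to a uniformly random neighbour if $a_i=1$, keep the packets if $a_i=0$). Queue $i$ then has arrival rate $\lambda_t^i=\lambda(t)\bigl(1-a_i+\sum_{j\in N_i}a_j/|N_j|\bigr)$ during the epoch. Given the states and actions, the queues evolve independently: $z_i(t+1)$ is the state, at time $\Delta t$, of the continuous-time Markov chain on $\mathcal Z$ started in $z_i(t)$ with arrival rate $\lambda_t^i$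 (arrivals at a full queue are dropped) and serving rate $\alpha$. Let $D_i(t)$ be the expected number of packets dropped at queue $i$ in epoch $t$, given the states and actions at its start. The modulating chain, the initial data below and the randomness of the dynamics are independent. *Limit.* Let $\mathcal G_*$ be the space of connected marked rooted graphs $(G,\varnothing,\mathbf z)$ with the topology of local convergence: $(G_n,\varnothing_n,\mathbf z_n)\to(G,\varnothing,\mathbf z)$ if for every $k$ the $k$-hop neighbourhoods of the roots are isomorphic as marked rooted graphs for all large $n$. Let $(G_n,\mathbf z_n)$, $n\in\mathbb N$, be random nonempty finite graphs with initial states in $\mathcal Z^{G_n}$ that converge in probability in the local weak sense to a random element $(G,\varnothing,\mathbf z)$ of $\mathcal G_*$, i.e. $\frac1{|G_n|}\sum_{i\in G_n}f(C_i(G_n))\to\mathbb E[f(G)]$ in probability for every bounded continuous $f\colon\mathcal G_*\to\mathbb R$, where $C_i(G_n)$ is the connected component of $i$ in $G_n$, rooted at $i$, with its marks. *Policies and objectives.* An MFC policy $\pi$ assigns a decision rule to each epoch $t$, modulating state $m_t$ and law on $\mathcal G_*$. It generates the rules $\zeta_t=\pi_t\bigl(m_t,\mathcal L(G(t),\mathbf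 z(t))\bigr)$, where $\mathcal L(G(t),\mathbf z(t))$ is the law, conditional on the arrival rates before epoch $t$, of the limiting system at the start of epoch $t$ after $\zeta_0,\dots,\zeta_{t-1}$ were applied. Set $$J^{G,\mathbf z}(\pi)=-\mathbb E\Bigl[\sum_{t=0}^\infty\gamma^tD_\varnothing(t)\Bigr],\qquad J^{G_n,\mathbf z_n}(\pi)=-\mathbb E\Bigl[\sum_{t=0}^\infty\gamma^t\frac1{|G_n|}\sum_{i\in G_n}D_i(t)\Bigr],$$ where in the limiting system and in the finite systems all agents apply these same rules $\zeta_t$. **Corollary.** Let $\pi_1,\dots,\pi_K$ be MFC policies whose objective values $J^{G,\mathbf z}(\pi_1),\dots,J^{G,\mathbf z}(\pi_K)$ are pairwise distinct, and let $\pi_i$ be the policy with $J^{G,\mathbf z}(\pi_i)\ge\max_jJ^{G,\mathbf z}(\pi_j)$. Then there exists $n'$ such that for all $n>n'$ $$J^{G_n,\mathbf z_n}(\pi_i)\ge\max_jJ^{G_n,\mathbf z_n}(\pi_j).$$ -/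

import Mathlib

open MeasureTheory Filter
open scoped Topology unitInterval BoundedContinuousFunction

noncomputable section

namespace SparseQueue

/-! ### Parameters of the queueing system -/

/-- Parameters of the queueing system: finite buffer, serving rate `α > 0`, synchronization delay
`Δt > 0`, discount factor `γ ∈ [0, 1)`, and the Markov chain (initial law, transition law, on a
set `M` of modulating states) that modulates the per-agent arrival rate of the epochs. -/
structure Model (M : Type*) where
  buffer : ℕ
  serviceRate : ℝ
  serviceRate_pos : 0 < serviceRate
  delay : ℝ
  delay_pos : 0 < delay
  discount : ℝ
  discount_nonneg : 0 ≤ discount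
  discount_lt_one : discount < 1
  rate : M → ℝ
  rate_nonneg : ∀ x, 0 ≤ rate x
  init : PMF M
  trans : M → PMF M

/-- Queue fillings `{0, 1, …, B}`. -/
abbrev Filling (B : ℕ) : Type := Fin (B + 1)

/-- A decentralized decision rule: the probability of offloading (action `1`) given the filling of
the own queue. -/
abbrev Rule (B : ℕ) : Type := Filling B → I

/-- `m` is a Markov chain with the initial law and the transition law of the model. -/
structure Model.IsModulatingChain {M Ω : Type*} [MeasurableSpace Ω] (mdl : Model M)
    (P : Measure Ω) (m : ℕ → Ω → M) : Prop where
  measurableSet_eq : ∀ t x, MeasurableSet {ω | m t ω = x}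
  path_prob : ∀ (t : ℕ) (p : ℕ → M),
    P {ω | ∀ s ≤ t, m s ω = p s} =
      mdl.init (p 0) * ∏ s ∈ Finset.range t, mdl.trans (p s) (p (s + 1))

/-! ### A single queue during one epoch -/

/-- Off-diagonal part of the generator of a queue with buffer `B`, arrival rate `r` and serving
rate `α`; the column is the current filling, the row is the next one. -/
def jumpMatrix (B : ℕ) (α r : ℝ) : Matrix (Filling B) (Filling B) ℝ :=
  Matrix.of fun y x =>
    if (y : ℕ) = (x : ℕ) + 1 then r else if (y : ℕ) + 1 = (x : ℕ) then α else 0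

/-- Generator of the queue (every column sums to zero). -/
def generator (B : ℕ) (α r : ℝ) : Matrix (Filling B) (Filling B) ℝ :=
  jumpMatrix B α r - Matrix.diagonal fun x => ∑ y, jumpMatrix B α r y x

/-- The generator extended by one row that counts the arrivals at the full queue. -/
def lossGenerator (B : ℕ) (α r : ℝ) : Matrix (Filling B ⊕ Unit) (Filling B ⊕ Unit) ℝ :=
  Matrix.fromBlocks (generator B α r) 0
    (Matrix.of fun _ x => if x = Fin.last B then r else 0) 0

variable {M : Type*} (mdl : Model M)

/-- Probability that a queue with filling `x` at the start of an epoch and arrival rate `r` during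
the epoch has filling `y` at its end (Kolmogorov forward equation). -/
def Model.transitionProb (r : ℝ) (x y : Filling mdl.buffer) : ℝ :=
  NormedSpace.exp (mdl.delay • generator mdl.buffer mdl.serviceRate r) y x

/-- Expected number of packets dropped during an epoch at a queue with filling `x` at the start of
the epoch and arrival rate `r` during the epoch. -/
def Model.expectedDrops (r : ℝ) (x : Filling mdl.buffer) : ℝ :=
  NormedSpace.exp (mdl.delay • lossGenerator mdl.buffer mdl.serviceRate r)
    (Sum.inr ()) (Sum.inl x)

/-- Sampling of the next filling by the quantile function of the law `transitionProb r x`: if `u`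
is uniform on `[0, 1]`, then `nextFilling r x u` has this law. -/
def Model.nextFilling (r : ℝ) (x : Filling mdl.buffer) (u : I) : Filling mdl.buffer :=
  ⟨((Finset.range mdl.buffer).filter fun k =>
      ∑ y : Filling mdl.buffer, (if (y : ℕ) ≤ k then mdl.transitionProb r x y else 0) < (u : ℝ)).card,
    Nat.lt_succ_of_le ((Finset.card_filter_le _ _).trans (Finset.card_range _).le)⟩

/-! ### The interacting system on a graph -/

/-- Arrival rate `r (1 - a_i + ∑_{j ∈ N_i} a_j / |N_j|)` at the queue of agent `i` under the joint
action `a`. -/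
def arrivalRate {V : Type} (G : SimpleGraph V) (r : ℝ) (a : V → Fin 2) (i : V) : ℝ :=
  r * (1 - ((a i : ℕ) : ℝ) +
    ∑ᶠ j ∈ G.neighborSet i, ((a j : ℕ) : ℝ) / ((G.neighborSet j).ncard : ℝ))

/-- Noise: for each epoch and each agent a pair of uniform variables, the first for the choice of
the action and the second for the evolution of the queue. -/
abbrev Noise (V : Type) : Type := ℕ × V → I × I

/-- Law of the noise: all coordinates independent and uniform. -/
def noiseLaw (V : Type) : Measure (Noise V) :=
  Measure.infinitePi fun _ => (volume : Measure (I × I))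

section Dynamics

variable {V : Type} (G : SimpleGraph V) (z : V → Filling mdl.buffer)
  (lam : ℕ → ℝ) (ζ : ℕ → Rule mdl.buffer) (ξ : Noise V)

/-- The actions drawn in epoch `t` by the rule `ζ` in the joint state `x`: agent `i` offloads
(`1`) with probability `ζ (x i)`, and keeps its packets (`0`) otherwise. -/
def drawActions {B : ℕ} {V : Type} (ξ : Noise V) (t : ℕ) (ζ : Rule B) (x : V → Filling B) :
    V → Fin 2 :=
  fun i => if (ξ (t, i)).1 < ζ (x i) then 1 else 0

/-- Joint state of all queues at the start of epoch `t`, for the initial state `z`, the arrival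
rates `lam` and the decision rules `ζ`. -/
def Model.state : ℕ → V → Filling mdl.buffer
  | 0 => z
  | t + 1 => fun i =>
      mdl.nextFilling
        (arrivalRate G (lam t) (drawActions ξ t (ζ t) (Model.state t)) i)
        (Model.state t i) (ξ (t, i)).2

/-- Expected number of packets dropped in epoch `t` at the queue of agent `i`, given the states and
the actions at the start of that epoch. -/
def Model.drops (t : ℕ) (i : V) : ℝ :=
  mdl.expectedDrops
    (arrivalRate G (lam t) (drawActions ξ t (ζ t) (mdl.state G z lam ζ ξ t)) i)
    (mdl.state G z lam ζ ξ t i)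

end Dynamics

/-! ### Marked rooted graphs and local weak convergence -/

/-- Connected marked rooted graphs in which every node has at most `d` neighbours. -/
structure MarkedRootedGraph (d B : ℕ) where
  V : Type
  graph : SimpleGraph V
  connected : graph.Connected
  degree_le : ∀ i, (graph.neighborSet i).encard ≤ d
  root : V
  mark : V → Filling B

namespace MarkedRootedGraph

variable {d B : ℕ}

/-- The nodes at distance at most `k` from the root. -/
def ball (g : MarkedRootedGraph d B) (k : ℕ) : Set g.V := {v | g.graph.dist g.root v ≤ k}

/-- The `k`-balls around the roots are isomorphic as marked rooted graphs. -/
def BallIso (k : ℕ) (g h : MarkedRootedGraph d B) : Prop :=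
  ∃ φ : g.graph.induce (g.ball k) ≃g h.graph.induce (h.ball k),
    (∀ v : g.ball k, (v : g.V) = g.root → (φ v : h.V) = h.root) ∧
      ∀ v : g.ball k, h.mark (φ v) = g.mark v

/-- The topology of local convergence. Isomorphic graphs are topologically indistinguishable, so
that open sets, continuous functions and Borel measures are those of the space of isomorphism
classes. -/
instance : TopologicalSpace (MarkedRootedGraph d B) :=
  TopologicalSpace.generateFrom {U | ∃ k g, U = {h | BallIso k g h}}

instance : MeasurableSpace (MarkedRootedGraph d B) := borel _

/-- The same rooted graph with other marks. -/
def withMark (g : MarkedRootedGraph d B) (x : g.V → Filling B) : MarkedRootedGraph d B where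
  V := g.V
  graph := g.graph
  connected := g.connected
  degree_le := g.degree_le
  root := g.root
  mark := x

end MarkedRootedGraph

/-- A finite system: a nonempty finite graph in which every node has at most `d` neighbours, and
the initial queue fillings of its nodes. -/
structure FiniteSystem (d B : ℕ) where
  size : ℕ
  size_pos : 0 < size
  graph : SimpleGraph (Fin size)
  degree_le : ∀ i, (graph.neighborSet i).encard ≤ d
  mark : Fin size → Filling B

/-- There are countably many finite systems; every set of them is an event. -/
instance (d B : ℕ) : MeasurableSpace (FiniteSystem d B) := ⊤

namespace FiniteSystem

variable {d B : ℕ}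

/-- The connected component of the node `i`, with root `i`. -/
def component (s : FiniteSystem d B) (i : Fin s.size) : MarkedRootedGraph d B where
  V := s.graph.connectedComponentMk i
  graph := (s.graph.connectedComponentMk i).toSimpleGraph
  connected := (s.graph.connectedComponentMk i).connected_toSimpleGraph
  degree_le := fun j =>
    (Function.Injective.encard_image Subtype.val_injective _).symm.le.trans
      ((Set.encard_le_encard (by
        rintro _ ⟨v, hv, rfl⟩
        exact hv)).trans (s.degree_le j))
  root := ⟨i, rfl⟩
  mark := fun v => s.mark v

/-- The average `|G|⁻¹ ∑_{i ∈ G} f (C_i(G))`. -/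
def average (s : FiniteSystem d B) (f : MarkedRootedGraph d B → ℝ) : ℝ :=
  (∑ i, f (s.component i)) / (s.size : ℝ)

end FiniteSystem

/-- Convergence in probability in the local weak sense of random finite systems (with laws `μ n`)
to a random marked rooted graph (with law `L`). -/
def ConvergesLocallyWeakly {d B : ℕ} (μ : ℕ → Measure (FiniteSystem d B))
    (L : Measure (MarkedRootedGraph d B)) : Prop :=
  ∀ f : MarkedRootedGraph d B →ᵇ ℝ, ∀ ε : ℝ, 0 < ε →
    Tendsto (fun n => μ n {s | ε ≤ |s.average f - ∫ g, f g ∂L|}) atTop (𝓝 0)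

/-! ### The mean field control problem -/

variable {d : ℕ}

/-- The law of the limiting system `(G(t), z(t))` at the start of epoch `t`, for the arrival rates
`lam`, after the decision rules `ζ 0, …, ζ (t - 1)` were applied from the initial law `L`. -/
def Model.systemLaw (L : Measure (MarkedRootedGraph d mdl.buffer)) (lam : ℕ → ℝ)
    (ζ : ℕ → Rule mdl.buffer) (t : ℕ) : Measure (MarkedRootedGraph d mdl.buffer) :=
  L.bind fun g =>
    (noiseLaw g.V).map fun ξ => g.withMark (mdl.state g.graph g.mark lam ζ ξ t)

/-- An upper-level MFC policy: it assigns a decision rule to the current state of the MFC decision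
process, that is, to the law of the limiting system (conditionally on the past arrival rates) and
to the current modulating state; it may depend on the epoch. -/
abbrev MFCPolicy (M : Type*) (d B : ℕ) : Type _ :=
  ℕ → M → Measure (MarkedRootedGraph d B) → Rule B

/-- The decision rules `ζ_t = π(𝓛(G(t), z(t)))` that the policy `π` generates in the MFC decision
process along the path `p` of modulating states. The law at time `t` depends on the rules before
time `t` only; the rule `0` is a placeholder for the others. -/
def Model.mfcRule (π : MFCPolicy M d mdl.buffer) (L : Measure (MarkedRootedGraph d mdl.buffer))
    (p : ℕ → M) (t : ℕ) : Rule mdl.buffer :=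
  π t (p t) (mdl.systemLaw L (fun s => mdl.rate (p s))
    (fun s => if _h : s < t then Model.mfcRule π L p s else 0) t)
termination_by t

theorem Model.state_congr {V : Type} (G : SimpleGraph V) (z : V → Filling mdl.buffer)
    (lam : ℕ → ℝ) (ζ ζ' : ℕ → Rule mdl.buffer) (ξ : Noise V) (t : ℕ)
    (h : ∀ s < t, ζ s = ζ' s) : mdl.state G z lam ζ ξ t = mdl.state G z lam ζ' ξ t := by
  induction t with
  | zero => rfl
  | succ t ih =>
    have h1 := ih fun s hs => h s (Nat.lt_succ_of_lt hs)
    funext i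
    simp only [Model.state, h1, h t (Nat.lt_succ_self t)]

/-- The closed-loop equation `ζ_t = π(𝓛(G(t), z(t)))`. -/
theorem Model.mfcRule_eq (π : MFCPolicy M d mdl.buffer)
    (L : Measure (MarkedRootedGraph d mdl.buffer)) (p : ℕ → M) (t : ℕ) :
    mdl.mfcRule π L p t =
      π t (p t) (mdl.systemLaw L (fun s => mdl.rate (p s)) (mdl.mfcRule π L p) t) := by
  rw [Model.mfcRule]
  congr 1
  unfold Model.systemLaw
  congr 1
  funext g
  congr 1
  funext ξ
  congr 1
  exact mdl.state_congr _ _ _ _ _ _ _ fun s hs => by simp [hs]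

/-! ### Objectives -/

variable {Ω : Type*} [MeasurableSpace Ω]

/-- The MFC objective `J^{G,z}(π) = - 𝔼 [∑_t γ^t D(t)]`, where `D(t)` is the number of packets
dropped at the root. The expectation is over the modulating chain, the random marked rooted graph
with law `L`, and the independent noise. -/
def Model.mfcObjective (P : Measure Ω) (m : ℕ → Ω → M)
    (L : Measure (MarkedRootedGraph d mdl.buffer)) (π : MFCPolicy M d mdl.buffer) : ℝ :=
  -∫ ω, ∫ g, ∫ ξ, ∑' t : ℕ, mdl.discount ^ t *
      mdl.drops g.graph g.mark (fun k => mdl.rate (m k ω))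
        (mdl.mfcRule π L fun k => m k ω) ξ t g.root
    ∂(noiseLaw g.V) ∂L ∂P

/-- The objective `J^{G_n,z_n}(π) = - 𝔼 [∑_t γ^t D^N(t)]` of the random finite system with law `μ`,
where `D^N(t)` is the average over all agents of the numbers of packets dropped, and where all
agents apply the decision rules that `π` generates in the MFC decision process started in `L`. -/
def Model.finiteObjective (P : Measure Ω) (m : ℕ → Ω → M)
    (L : Measure (MarkedRootedGraph d mdl.buffer)) (μ : Measure (FiniteSystem d mdl.buffer))
    (π : MFCPolicy M d mdl.buffer) : ℝ :=
  -∫ ω, ∫ s, ∫ ξ, ∑' t : ℕ, mdl.discount ^ t *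
      ((∑ i, mdl.drops s.graph s.mark (fun k => mdl.rate (m k ω))
        (mdl.mfcRule π L fun k => m k ω) ξ t i) / (s.size : ℝ))
    ∂(noiseLaw (Fin s.size)) ∂μ ∂P

end SparseQueue

end

noncomputable section

namespace SparseQueue

variable {M : Type*} (mdl : Model M)

/-! There are finitely many policies with distinct limiting objectives, so it suffices that each
finite objective converges to the limiting one (`Model.tendsto_finiteObjective`); strict
inequalities between limits then persist for large `n`.

The rules are generated from `L` and the modulating path alone, so for a fixed path every system
uses the same deterministic sequence of rules. Information spreads by boundedly many edges per
epoch, hence the mean drops at a node in epoch `t` depend only on the marked ball of radius `2 * t +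
2` around it (`Model.meanDrops_eq_of_ballIso`). They are uniformly bounded, so the discounted sum
`Model.discountedDrops` converges uniformly and is a bounded continuous function of the marked
rooted graph. The finite objective integrates its average over components, the limiting one its
integral against `L`. Local weak convergence gives convergence in probability of these averages,
boundedness turns this into convergence of expectations, and dominated convergence handles the
modulating path. -/

/-! ### Locality of the dynamics -/

/-- An injection `e` of graphs under which the neighbourhoods of all nodes of positive depth `r`
correspond to each other, where the depth drops by at most one along an edge. -/
structure IsLocalEmbedding {U V : Type} (H : SimpleGraph U) (G : SimpleGraph V) (e : U → V)
    (r : U → ℕ) : Prop where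
  injective : Function.Injective e
  neighborSet_eq : ∀ u, 1 ≤ r u → G.neighborSet (e u) = e '' H.neighborSet u
  depth_le : ∀ u v, H.Adj u v → r u ≤ r v + 1

/-- The noise seen by the nodes of `U` through the map `e`. -/
def pullNoise {U V : Type} (e : U → V) (ξ : Noise V) : Noise U := fun q => ξ (q.1, e q.2)

section

variable {U V : Type} {H : SimpleGraph U} {G : SimpleGraph V} {e : U → V} {r : U → ℕ}

/-- Depth two is needed because the rate involves the degrees of the neighbours, which must
therefore have positive depth themselves. -/
theorem IsLocalEmbedding.arrivalRate_eq (he : IsLocalEmbedding H G e r) (ρ : ℝ)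
    {a : V → Fin 2} {b : U → Fin 2} {u : U} (hu : 2 ≤ r u) (hau : a (e u) = b u)
    (ha : ∀ v, H.Adj u v → a (e v) = b v) :
    arrivalRate G ρ a (e u) = arrivalRate H ρ b u := by
  unfold arrivalRate
  rw [he.neighborSet_eq u (by omega), finsum_mem_image he.injective.injOn, hau]
  congr 2
  refine finsum_mem_congr rfl fun v hv => ?_
  have hv' : H.Adj u v := hv
  have := he.depth_le u v hv'
  rw [he.neighborSet_eq v (by omega), Set.ncard_image_of_injective _ he.injective, ha v hv']

theorem drawActions_pullNoise {B : ℕ} (ξ : Noise V) (t : ℕ) (ρ : Rule B) {x : V → Filling B}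
    {y : U → Filling B} {u : U} (h : x (e u) = y u) :
    drawActions ξ t ρ x (e u) = drawActions (pullNoise e ξ) t ρ y u := by
  unfold drawActions
  rw [h]
  rfl

/-- One epoch consults the states of neighbours, one level less deep, and their degrees. Two levels
per epoch cover both; this is not optimal, but any finite radius serves. -/
theorem IsLocalEmbedding.state_eq (he : IsLocalEmbedding H G e r) (z : V → Filling mdl.buffer)
    (lam : ℕ → ℝ) (ζ : ℕ → Rule mdl.buffer) (ξ : Noise V) (t : ℕ) :
    ∀ u, 2 * t ≤ r u →
      mdl.state G z lam ζ ξ t (e u) = mdl.state H (z ∘ e) lam ζ (pullNoise e ξ) t u := by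
  induction t with
  | zero => exact fun _ _ => rfl
  | succ t ih =>
    intro u hu
    have hu' := ih u (by omega)
    simp only [Model.state, hu']
    rw [he.arrivalRate_eq (lam t) (a := drawActions ξ t (ζ t) (mdl.state G z lam ζ ξ t))
      (b := drawActions (pullNoise e ξ) t (ζ t) (mdl.state H (z ∘ e) lam ζ (pullNoise e ξ) t))
      (by omega) (drawActions_pullNoise ξ t _ hu')]
    · rfl
    · intro v hv
      have := he.depth_le u v hv
      exact drawActions_pullNoise ξ t _ (ih v (by omega))

theorem IsLocalEmbedding.drops_eq (he : IsLocalEmbedding H G e r) (z : V → Filling mdl.buffer)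
    (lam : ℕ → ℝ) (ζ : ℕ → Rule mdl.buffer) (ξ : Noise V) (t : ℕ) (u : U)
    (hu : 2 * t + 2 ≤ r u) :
    mdl.drops G z lam ζ ξ t (e u) = mdl.drops H (z ∘ e) lam ζ (pullNoise e ξ) t u := by
  have hu' := he.state_eq mdl z lam ζ ξ t u (by omega)
  unfold Model.drops
  rw [hu', he.arrivalRate_eq (lam t)
    (b := drawActions (pullNoise e ξ) t (ζ t) (mdl.state H (z ∘ e) lam ζ (pullNoise e ξ) t))
    (by omega) (drawActions_pullNoise ξ t _ hu')]
  intro v hv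
  have := he.depth_le u v hv
  exact drawActions_pullNoise ξ t _ (he.state_eq mdl z lam ζ ξ t v (by omega))

theorem measurable_pullNoise (e : U → V) : Measurable (pullNoise e) :=
  measurable_pi_lambda _ fun _ => measurable_pi_apply _

instance (V : Type) : IsProbabilityMeasure (noiseLaw V) := by
  unfold noiseLaw; infer_instance

/-- Reindexing an i.i.d. family along an injection leaves it i.i.d.: a finite cylinder pulls back to
the cylinder over the image indices, with the same product of measures. -/
theorem map_pullNoise (he : Function.Injective e) :
    (noiseLaw V).map (pullNoise e) = noiseLaw U := by
  classical
  refine Measure.eq_infinitePi _ fun s t ht => ?_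
  have hinj : Function.Injective fun q : ℕ × U => (q.1, e q.2) := fun p q h => by
    simp only [Prod.mk.injEq] at h
    exact Prod.ext h.1 (he h.2)
  rw [Measure.map_apply (measurable_pullNoise e)
    (MeasurableSet.pi s.countable_toSet fun i _ => ht i)]
  -- The value `∅` off the range is never used, since the cylinder below constrains only indices in
  -- the image.
  let t' : ℕ × V → Set (I × I) := Function.extend (fun q : ℕ × U => (q.1, e q.2)) t fun _ => ∅
  have ht' : ∀ q : ℕ × U, t' (q.1, e q.2) = t q := fun q => hinj.extend_apply _ _ q
  have hpre : pullNoise e ⁻¹' Set.pi s t =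
      Set.pi (s.image fun q : ℕ × U => (q.1, e q.2)) t' := by
    ext ξ
    simp only [Set.mem_preimage, Set.mem_pi, Finset.mem_coe, Finset.mem_image,
      forall_exists_index, and_imp, forall_apply_eq_imp_iff₂, ht', pullNoise]
  rw [hpre, noiseLaw, Measure.infinitePi_pi, Finset.prod_image hinj.injOn]
  · simp only [ht']
  · intro q hq
    obtain ⟨p, -, rfl⟩ := Finset.mem_image.1 hq
    rw [ht']
    exact ht p

end

/-! ### Measurability and boundedness -/

section ExpContinuity

attribute [local instance] Matrix.linftyOpNormedRing Matrix.linftyOpNormedAlgebra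

theorem continuous_matrix_exp (n : Type*) [Fintype n] [DecidableEq n] :
    Continuous (NormedSpace.exp : Matrix n n ℝ → Matrix n n ℝ) :=
  NormedSpace.exp_continuous

end ExpContinuity

theorem continuous_generator (B : ℕ) (α : ℝ) : Continuous fun r => generator B α r := by
  have hj : ∀ y x, Continuous fun r => jumpMatrix B α r y x := fun y x => by
    simp only [jumpMatrix, Matrix.of_apply]
    split_ifs <;> fun_prop
  refine continuous_matrix fun y x => ?_
  simp only [generator, Matrix.sub_apply, Matrix.diagonal_apply]
  refine (hj y x).sub ?_
  split_ifs
  · exact continuous_finsetSum _ fun _ _ => hj _ _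
  · exact continuous_const

theorem continuous_lossGenerator (B : ℕ) (α : ℝ) : Continuous fun r => lossGenerator B α r := by
  refine Continuous.matrix_fromBlocks (continuous_generator B α) continuous_const
    (continuous_matrix fun y x => ?_) continuous_const
  simp only [Matrix.of_apply]
  split_ifs <;> fun_prop

theorem Model.continuous_transitionProb (x y : Filling mdl.buffer) :
    Continuous fun r => mdl.transitionProb r x y :=
  ((continuous_matrix_exp _).comp
    ((continuous_generator mdl.buffer mdl.serviceRate).fun_const_smul mdl.delay)).matrix_elem y x

theorem Model.continuous_expectedDrops (x : Filling mdl.buffer) :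
    Continuous fun r => mdl.expectedDrops r x :=
  ((continuous_matrix_exp _).comp ((continuous_lossGenerator mdl.buffer
    mdl.serviceRate).fun_const_smul mdl.delay)).matrix_elem (Sum.inr ()) (Sum.inl x)

/-- Joint measurability is needed because the rate is itself random. The filling counts threshold
events, each comparing a continuous function of the rate with the uniform variable. -/
theorem Model.measurable_nextFilling (x : Filling mdl.buffer) :
    Measurable fun q : ℝ × I => mdl.nextFilling q.1 x q.2 := by
  have hset : ∀ k : ℕ, MeasurableSet {q : ℝ × I |
      ∑ y : Filling mdl.buffer, (if (y : ℕ) ≤ k then mdl.transitionProb q.1 x y else 0)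
        < (q.2 : ℝ)} := fun k => by
    refine measurableSet_lt ?_ (measurable_subtype_coe.comp measurable_snd)
    refine Finset.measurable_sum _ fun y _ => ?_
    split_ifs
    · exact (mdl.continuous_transitionProb x y).measurable.comp measurable_fst
    · exact measurable_const
  have hcard : Measurable fun q : ℝ × I => ((mdl.nextFilling q.1 x q.2 : Filling _) : ℕ) := by
    simp only [Model.nextFilling, Finset.card_filter]
    exact Finset.measurable_sum _ fun k _ =>
      Measurable.ite (hset k) measurable_const measurable_const
  refine measurable_to_countable' fun y => ?_
  convert hcard (measurableSet_singleton (y : ℕ)) using 1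
  ext q
  simp [Fin.ext_iff]

section

variable {V : Type} {G : SimpleGraph V} (z : V → Filling mdl.buffer)
  (lam : ℕ → ℝ) (ζ : ℕ → Rule mdl.buffer)

theorem measurable_arrivalRate (hG : ∀ i, (G.neighborSet i).Finite) {X : Type*}
    [MeasurableSpace X] {a : X → V → Fin 2} (ha : ∀ i, Measurable fun x => a x i) (r : ℝ) (i : V) :
    Measurable fun x => arrivalRate G r (a x) i := by
  have hc : ∀ j, Measurable fun x => ((a x j : ℕ) : ℝ) := fun j =>
    (measurable_of_countable fun b : Fin 2 => ((b : ℕ) : ℝ)).comp (ha j)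
  unfold arrivalRate
  simp only [finsum_mem_eq_finite_toFinset_sum _ (hG i)]
  exact ((measurable_const.sub (hc i)).add
    (Finset.measurable_sum _ fun j _ => (hc j).div_const _)).const_mul r

theorem measurable_drawActions {B : ℕ} (t : ℕ) (ρ : Rule B) {x : Noise V → V → Filling B}
    (hx : ∀ i, Measurable fun ξ => x ξ i) (i : V) :
    Measurable fun ξ => drawActions ξ t ρ (x ξ) i := by
  unfold drawActions
  refine Measurable.ite (measurableSet_lt ?_ ?_) measurable_const measurable_const
  · exact (measurable_pi_apply (t, i)).fst
  · exact (measurable_of_countable ρ).comp (hx i)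

theorem Model.measurable_state (hG : ∀ i, (G.neighborSet i).Finite) (t : ℕ) :
    ∀ i, Measurable fun ξ => mdl.state G z lam ζ ξ t i := by
  induction t with
  | zero => exact fun i => measurable_const
  | succ t ih =>
    intro i
    have h : Measurable fun q : (ℝ × I) × Filling mdl.buffer => mdl.nextFilling q.1.1 q.2 q.1.2 :=
      measurable_from_prod_countable_left fun x => mdl.measurable_nextFilling x
    have ha : Measurable fun ξ : Noise V =>
        arrivalRate G (lam t) (drawActions ξ t (ζ t) (mdl.state G z lam ζ ξ t)) i :=
      measurable_arrivalRate hG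
        (measurable_drawActions (x := fun ξ => mdl.state G z lam ζ ξ t) t (ζ t) ih) (lam t) i
    have hu : Measurable fun ξ : Noise V => (ξ (t, i)).2 := (measurable_pi_apply (t, i)).snd
    simpa only [Function.comp_def, Model.state] using h.comp ((ha.prodMk hu).prodMk (ih i))

theorem Model.measurable_drops (hG : ∀ i, (G.neighborSet i).Finite) (t : ℕ) (i : V) :
    Measurable fun ξ => mdl.drops G z lam ζ ξ t i := by
  have h : Measurable fun q : ℝ × Filling mdl.buffer => mdl.expectedDrops q.1 q.2 :=
    measurable_from_prod_countable_left fun x => (mdl.continuous_expectedDrops x).measurable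
  have hx := mdl.measurable_state z lam ζ hG t
  have ha : Measurable fun ξ : Noise V =>
      arrivalRate G (lam t) (drawActions ξ t (ζ t) (mdl.state G z lam ζ ξ t)) i :=
    measurable_arrivalRate hG
      (measurable_drawActions (x := fun ξ => mdl.state G z lam ζ ξ t) t (ζ t) hx) (lam t) i
  simpa only [Function.comp_def, Model.drops] using h.comp (ha.prodMk (hx i))

theorem abs_arrivalRate_le {d : ℕ} (hG : ∀ i, (G.neighborSet i).encard ≤ d) {r R : ℝ}
    (hr : |r| ≤ R) (a : V → Fin 2) (i : V) : |arrivalRate G r a i| ≤ R * (1 + d) := by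
  have hfin : (G.neighborSet i).Finite := Set.finite_of_encard_le_coe (hG i)
  have hb : ∀ j, 0 ≤ ((a j : ℕ) : ℝ) ∧ ((a j : ℕ) : ℝ) ≤ 1 := fun j =>
    ⟨Nat.cast_nonneg _, by exact_mod_cast Nat.le_of_lt_succ (a j).2⟩
  have hterm : ∀ j, 0 ≤ ((a j : ℕ) : ℝ) / ((G.neighborSet j).ncard : ℝ) ∧
      ((a j : ℕ) : ℝ) / ((G.neighborSet j).ncard : ℝ) ≤ 1 := fun j => by
    refine ⟨div_nonneg (hb j).1 (Nat.cast_nonneg _), ?_⟩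
    -- At an isolated node the quotient is a division by zero, with value `0`.
    rcases Nat.eq_zero_or_pos (G.neighborSet j).ncard with h | h
    · simp [h]
    · have h1 : (1 : ℝ) ≤ (G.neighborSet j).ncard := by exact_mod_cast h
      exact div_le_one_of_le₀ ((hb j).2.trans h1) (by linarith)
  have hcard : (hfin.toFinset.card : ℝ) ≤ d := by
    have := hG i
    rw [hfin.encard_eq_coe_toFinset_card] at this
    exact_mod_cast this
  unfold arrivalRate
  rw [finsum_mem_eq_finite_toFinset_sum _ hfin, abs_mul]
  have h0 : 0 ≤ ∑ j ∈ hfin.toFinset, ((a j : ℕ) : ℝ) / ((G.neighborSet j).ncard : ℝ) :=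
    Finset.sum_nonneg fun j _ => (hterm j).1
  have h1 : ∑ j ∈ hfin.toFinset, ((a j : ℕ) : ℝ) / ((G.neighborSet j).ncard : ℝ) ≤ d :=
    (Finset.sum_le_card_nsmul _ _ 1 fun j _ => (hterm j).2).trans (by simpa using hcard)
  refine mul_le_mul hr ?_ (abs_nonneg _) ((abs_nonneg r).trans hr)
  have := hb i
  rw [abs_le]
  constructor <;> linarith

/-- Bounded degree confines the rates to one compact interval, on which the drops are continuous,
and there are finitely many fillings. The constant must not depend on the graph. -/
theorem Model.exists_abs_drops_le (d : ℕ) (R : ℝ) : ∃ C, ∀ {V : Type} (G : SimpleGraph V)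
    (_ : ∀ i, (G.neighborSet i).encard ≤ d) (z : V → Filling mdl.buffer) (lam : ℕ → ℝ)
    (_ : ∀ t, |lam t| ≤ R) (ζ : ℕ → Rule mdl.buffer) (ξ : Noise V) (t : ℕ) (i : V),
    |mdl.drops G z lam ζ ξ t i| ≤ C := by
  have hx : ∀ x, ∃ C, ∀ r ∈ Set.Icc (-(R * (1 + d))) (R * (1 + d)), ‖mdl.expectedDrops r x‖ ≤ C :=
    fun x => isCompact_Icc.exists_bound_of_continuousOn (mdl.continuous_expectedDrops x).continuousOn
  choose C hC using hx
  refine ⟨∑ x, |C x|, fun G hG z lam hlam ζ ξ t i => ?_⟩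
  refine (hC _ _ (abs_le.1 (abs_arrivalRate_le hG (hlam t) _ i))).trans ((le_abs_self _).trans ?_)
  exact Finset.single_le_sum (f := fun x => |C x|) (fun _ _ => abs_nonneg _) (Finset.mem_univ _)

end

/-! ### Expected drops at a node -/

/-- Expected number of packets dropped at node `i` in epoch `t`, over the noise. -/
def Model.meanDrops {V : Type} (G : SimpleGraph V) (z : V → Filling mdl.buffer) (lam : ℕ → ℝ)
    (ζ : ℕ → Rule mdl.buffer) (t : ℕ) (i : V) : ℝ :=
  ∫ ξ, mdl.drops G z lam ζ ξ t i ∂noiseLaw V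

section

variable {U V : Type} {H : SimpleGraph U} {G : SimpleGraph V} {e : U → V} {r : U → ℕ}

theorem IsLocalEmbedding.meanDrops_eq (he : IsLocalEmbedding H G e r)
    (hH : ∀ i, (H.neighborSet i).Finite) (z : V → Filling mdl.buffer)
    (lam : ℕ → ℝ) (ζ : ℕ → Rule mdl.buffer) (t : ℕ) (u : U) (hu : 2 * t + 2 ≤ r u) :
    mdl.meanDrops G z lam ζ t (e u) = mdl.meanDrops H (z ∘ e) lam ζ t u := by
  unfold Model.meanDrops
  rw [← map_pullNoise he.injective, integral_map (measurable_pullNoise e).aemeasurable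
    (mdl.measurable_drops _ lam ζ hH t u).aestronglyMeasurable]
  exact integral_congr_ae (ae_of_all _ fun ξ => he.drops_eq mdl z lam ζ ξ t u hu)

end

theorem Model.state_congr_of_forall_lt {V : Type} (G : SimpleGraph V) (z : V → Filling mdl.buffer)
    {lam lam' : ℕ → ℝ} {ζ ζ' : ℕ → Rule mdl.buffer} (ξ : Noise V) (t : ℕ)
    (hlam : ∀ s < t, lam s = lam' s) (hζ : ∀ s < t, ζ s = ζ' s) :
    mdl.state G z lam ζ ξ t = mdl.state G z lam' ζ' ξ t := by
  induction t with
  | zero => rfl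
  | succ t ih =>
    have h1 := ih (fun s hs => hlam s (by omega)) fun s hs => hζ s (by omega)
    funext i
    simp only [Model.state, h1, hζ t (Nat.lt_succ_self t), hlam t (Nat.lt_succ_self t)]

theorem Model.meanDrops_congr {V : Type} (G : SimpleGraph V) (z : V → Filling mdl.buffer)
    {lam lam' : ℕ → ℝ} {ζ ζ' : ℕ → Rule mdl.buffer} (t : ℕ) (i : V)
    (hlam : ∀ s ≤ t, lam s = lam' s) (hζ : ∀ s ≤ t, ζ s = ζ' s) :
    mdl.meanDrops G z lam ζ t i = mdl.meanDrops G z lam' ζ' t i := by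
  unfold Model.meanDrops Model.drops
  simp only [mdl.state_congr_of_forall_lt G z _ t (fun s hs => hlam s hs.le) fun s hs => hζ s hs.le,
    hlam t le_rfl, hζ t le_rfl]

/-- Causality of the closed loop. Strong induction is needed because the law at time `t` involves
all earlier rules. -/
theorem Model.mfcRule_congr {d : ℕ} (π : MFCPolicy M d mdl.buffer)
    (L : Measure (MarkedRootedGraph d mdl.buffer)) {p q : ℕ → M} (t : ℕ)
    (h : ∀ s ≤ t, p s = q s) : mdl.mfcRule π L p t = mdl.mfcRule π L q t := by
  induction t using Nat.strong_induction_on with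
  | _ t ih =>
    rw [Model.mfcRule_eq, Model.mfcRule_eq, h t le_rfl]
    unfold Model.systemLaw
    congr 2
    funext g
    congr 1
    funext ξ
    congr 1
    exact mdl.state_congr_of_forall_lt _ _ _ _ (fun s hs => by rw [h s hs.le])
      fun s hs => ih s hs fun k hk => h k (by omega)

/-! ### Continuity of local functions -/

namespace MarkedRootedGraph

variable {d B : ℕ}

theorem BallIso.refl (k : ℕ) (g : MarkedRootedGraph d B) : BallIso k g g :=
  ⟨SimpleGraph.Iso.refl, fun _ hv => hv, fun _ => rfl⟩

theorem isOpen_ballIso (k : ℕ) (g : MarkedRootedGraph d B) : IsOpen {h | BallIso k g h} :=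
  TopologicalSpace.isOpen_generateFrom_of_mem ⟨k, g, rfl⟩

theorem continuous_of_ballIso {X : Type*} [TopologicalSpace X] {f : MarkedRootedGraph d B → X}
    (k : ℕ) (hf : ∀ g h, BallIso k g h → f g = f h) : Continuous f := by
  refine IsLocallyConstant.continuous ((IsLocallyConstant.iff_exists_open f).2 fun g => ?_)
  exact ⟨_, isOpen_ballIso k g, BallIso.refl k g, fun h hh => (hf g h hh).symm⟩

instance : BorelSpace (MarkedRootedGraph d B) := ⟨rfl⟩

theorem root_mem_ball (g : MarkedRootedGraph d B) (k : ℕ) : g.root ∈ g.ball k := by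
  simp [ball]

theorem neighborSet_finite (g : MarkedRootedGraph d B) (i : g.V) :
    (g.graph.neighborSet i).Finite := Set.finite_of_encard_le_coe (g.degree_le i)

theorem neighborSet_induce_finite (g : MarkedRootedGraph d B) (S : Set g.V) (i : S) :
    ((g.graph.induce S).neighborSet i).Finite := by
  refine Set.Finite.of_finite_image ?_ (f := Subtype.val) Subtype.val_injective.injOn
  refine (g.neighborSet_finite i).subset ?_
  rintro _ ⟨v, hv, rfl⟩
  exact hv

/-- Depth is the distance left to the boundary of the ball; by the triangle inequality, a node of
positive depth has all its neighbours in the ball. -/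
theorem isLocalEmbedding_ball (g : MarkedRootedGraph d B) (k : ℕ) :
    IsLocalEmbedding (g.graph.induce (g.ball k)) g.graph Subtype.val
      (fun u => k - g.graph.dist g.root u) where
  injective := Subtype.val_injective
  neighborSet_eq := by
    intro u hu
    ext v
    simp only [SimpleGraph.mem_neighborSet, Set.mem_image, Subtype.exists, exists_and_right,
      exists_eq_right, SimpleGraph.comap_adj, Function.Embedding.subtype_apply]
    refine ⟨fun h => ⟨?_, h⟩, fun ⟨_, h⟩ => h⟩
    have h1 := g.connected.dist_triangle (u := g.root) (v := (u : g.V)) (w := v)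
    have h2 : g.graph.dist (u : g.V) v = 1 := SimpleGraph.dist_eq_one_iff_adj.2 h
    change g.graph.dist g.root v ≤ k
    omega
  depth_le := by
    intro u v h
    have h1 := g.connected.dist_triangle (u := g.root) (v := (u : g.V)) (w := v)
    have h2 : g.graph.dist (u : g.V) v = 1 := SimpleGraph.dist_eq_one_iff_adj.2 h
    omega

end MarkedRootedGraph

theorem _root_.SimpleGraph.Iso.isLocalEmbedding {U V : Type} {H : SimpleGraph U}
    {G : SimpleGraph V} (φ : H ≃g G) (n : ℕ) : IsLocalEmbedding H G φ fun _ => n where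
  injective := φ.injective
  neighborSet_eq := fun u _ => by
    ext v
    obtain ⟨w, rfl⟩ := φ.surjective v
    simp [φ.injective.eq_iff, φ.map_adj_iff]
  depth_le := by simp

/-- Three local embeddings are chained: the two inclusions of the balls and the isomorphism between
them. -/
theorem Model.meanDrops_eq_of_ballIso {d : ℕ} {g h : MarkedRootedGraph d mdl.buffer}
    (lam : ℕ → ℝ) (ζ : ℕ → Rule mdl.buffer) (t : ℕ)
    (hgh : MarkedRootedGraph.BallIso (2 * t + 2) g h) :
    mdl.meanDrops g.graph g.mark lam ζ t g.root = mdl.meanDrops h.graph h.mark lam ζ t h.root := by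
  obtain ⟨φ, hroot, hmark⟩ := hgh
  have hφ : φ ⟨g.root, g.root_mem_ball _⟩ = ⟨h.root, h.root_mem_ball _⟩ :=
    Subtype.ext (hroot _ rfl)
  have key (f : MarkedRootedGraph d mdl.buffer) :=
    (f.isLocalEmbedding_ball (2 * t + 2)).meanDrops_eq mdl (f.neighborSet_induce_finite _) f.mark
      lam ζ t ⟨f.root, f.root_mem_ball _⟩ (by simp)
  rw [key g, key h, ← hφ, (φ.isLocalEmbedding (2 * t + 2)).meanDrops_eq mdl
    (g.neighborSet_induce_finite _) _ lam ζ t _ le_rfl]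
  congr 1
  funext v
  exact (hmark v).symm

/-- A component has no boundary, so every node may be given the same arbitrary depth. -/
theorem FiniteSystem.isLocalEmbedding_component {d B : ℕ} (s : FiniteSystem d B)
    (i : Fin s.size) (n : ℕ) :
    IsLocalEmbedding (s.component i).graph s.graph Subtype.val fun _ => n where
  injective := Subtype.val_injective
  neighborSet_eq := fun u _ => by
    ext v
    constructor
    · intro h
      refine ⟨⟨v, ?_⟩, h, rfl⟩
      exact ((s.graph.connectedComponentMk i).mem_supp_congr_adj h).1 u.2
    · rintro ⟨w, hw, rfl⟩
      exact hw
  depth_le := by simp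

theorem Model.meanDrops_component {d : ℕ} (s : FiniteSystem d mdl.buffer) (i : Fin s.size)
    (lam : ℕ → ℝ) (ζ : ℕ → Rule mdl.buffer) (t : ℕ) :
    mdl.meanDrops s.graph s.mark lam ζ t i =
      mdl.meanDrops (s.component i).graph (s.component i).mark lam ζ t (s.component i).root :=
  (s.isLocalEmbedding_component i (2 * t + 2)).meanDrops_eq mdl (s.component i).neighborSet_finite
    s.mark lam ζ t (s.component i).root le_rfl

/-! ### Discounted sums -/

theorem integral_tsum_discounted {X : Type*} [MeasurableSpace X] (ν : Measure X)
    [IsProbabilityMeasure ν] {γ C : ℝ} (h0 : 0 ≤ γ) (h1 : γ < 1) {f : ℕ → X → ℝ}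
    (hf : ∀ t, Measurable (f t)) (hC : ∀ t x, |f t x| ≤ C) :
    ∫ x, ∑' t, γ ^ t * f t x ∂ν = ∑' t, γ ^ t * ∫ x, f t x ∂ν := by
  have hb : ∀ t x, ‖γ ^ t * f t x‖ ≤ γ ^ t * C := fun t x => by
    rw [norm_mul, Real.norm_of_nonneg (pow_nonneg h0 t)]
    exact mul_le_mul_of_nonneg_left (hC t x) (pow_nonneg h0 t)
  have hint : ∀ t, Integrable (fun x => γ ^ t * f t x) ν := fun t =>
    Integrable.of_bound ((hf t).const_mul _).aestronglyMeasurable _ (ae_of_all _ (hb t))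
  rw [← integral_tsum_of_summable_integral_norm hint]
  · simp only [integral_const_mul]
  · refine Summable.of_nonneg_of_le (fun t => integral_nonneg fun x => norm_nonneg _) (fun t => ?_)
      ((summable_geometric_of_lt_one h0 h1).mul_right C)
    calc ∫ x, ‖γ ^ t * f t x‖ ∂ν ≤ ∫ _, γ ^ t * C ∂ν :=
          integral_mono (hint t).norm (integrable_const _) (hb t)
      _ = γ ^ t * C := by simp

variable {d : ℕ}

/-- Expected discounted number of packets dropped at the root of `g` along the path `p` of
modulating states, under the rules generated by `π`. -/
def Model.discountedDrops (π : MFCPolicy M d mdl.buffer)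
    (L : Measure (MarkedRootedGraph d mdl.buffer)) (p : ℕ → M)
    (g : MarkedRootedGraph d mdl.buffer) : ℝ :=
  ∑' t : ℕ, mdl.discount ^ t *
    mdl.meanDrops g.graph g.mark (fun k => mdl.rate (p k)) (mdl.mfcRule π L p) t g.root

theorem Model.exists_drops_bound [Finite M] (d : ℕ) : ∃ C, ∀ {V : Type} (G : SimpleGraph V)
    (_ : ∀ i, (G.neighborSet i).encard ≤ d) (z : V → Filling mdl.buffer) (p : ℕ → M)
    (ζ : ℕ → Rule mdl.buffer) (ξ : Noise V) (t : ℕ) (i : V),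
    |mdl.drops G z (fun k => mdl.rate (p k)) ζ ξ t i| ≤ C := by
  cases nonempty_fintype M
  obtain ⟨C, hC⟩ := mdl.exists_abs_drops_le d (∑ x, |mdl.rate x|)
  exact ⟨C, fun G hG z p ζ ξ t i => hC G hG z _ (fun t => Finset.single_le_sum
    (f := fun x => |mdl.rate x|) (fun _ _ => abs_nonneg _) (Finset.mem_univ (p t))) ζ ξ t i⟩

section

variable (π : MFCPolicy M d mdl.buffer) (L : Measure (MarkedRootedGraph d mdl.buffer))

theorem Model.mfcObjective_eq [Finite M] {Ω : Type*} [MeasurableSpace Ω] (P : Measure Ω)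
    (m : ℕ → Ω → M) : mdl.mfcObjective P m L π =
      -∫ ω, ∫ g, mdl.discountedDrops π L (fun k => m k ω) g ∂L ∂P := by
  obtain ⟨C, hC⟩ := mdl.exists_drops_bound d
  unfold Model.mfcObjective Model.discountedDrops
  congr! with ω g
  exact integral_tsum_discounted _ mdl.discount_nonneg mdl.discount_lt_one
    (fun t => mdl.measurable_drops _ _ _ g.neighborSet_finite t g.root)
    fun t ξ => hC _ g.degree_le _ (fun k => m k ω) _ ξ t _

theorem Model.exists_meanDrops_bound [Finite M] (d : ℕ) : ∃ C, 0 ≤ C ∧ ∀ {V : Type}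
    (G : SimpleGraph V) (_ : ∀ i, (G.neighborSet i).encard ≤ d) (z : V → Filling mdl.buffer)
    (p : ℕ → M) (ζ : ℕ → Rule mdl.buffer) (t : ℕ) (i : V),
    |mdl.meanDrops G z (fun k => mdl.rate (p k)) ζ t i| ≤ C := by
  obtain ⟨C, hC⟩ := mdl.exists_drops_bound d
  refine ⟨|C|, abs_nonneg C, fun {V} G hG z p ζ t i => ?_⟩
  have := norm_integral_le_of_norm_le_const (μ := noiseLaw V)
    (f := fun ξ => mdl.drops G z (fun k => mdl.rate (p k)) ζ ξ t i)
    (ae_of_all _ fun ξ => (hC G hG z p ζ ξ t i).trans (le_abs_self C))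
  simpa [Model.meanDrops] using this

theorem Model.norm_discounted_le {C x : ℝ} (t : ℕ) (hx : |x| ≤ C) :
    ‖mdl.discount ^ t * x‖ ≤ mdl.discount ^ t * C := by
  have h0 := pow_nonneg mdl.discount_nonneg t
  rw [norm_mul, Real.norm_of_nonneg h0]
  exact mul_le_mul_of_nonneg_left hx h0

theorem Model.summable_discounted (C : ℝ) : Summable fun t : ℕ => mdl.discount ^ t * C :=
  (summable_geometric_of_lt_one mdl.discount_nonneg mdl.discount_lt_one).mul_right C

/-- This exhibits the same test function as in `Model.mfcObjective_eq`, now averaged over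
components, which is the form that local weak convergence controls. -/
theorem Model.finiteObjective_eq [Finite M] {Ω : Type*} [MeasurableSpace Ω] (P : Measure Ω)
    (m : ℕ → Ω → M) (μ : Measure (FiniteSystem d mdl.buffer)) :
    mdl.finiteObjective P m L μ π =
      -∫ ω, ∫ s, s.average (mdl.discountedDrops π L fun k => m k ω) ∂μ ∂P := by
  obtain ⟨C, hC⟩ := mdl.exists_drops_bound d
  obtain ⟨C', -, hC'⟩ := mdl.exists_meanDrops_bound d
  unfold Model.finiteObjective FiniteSystem.average Model.discountedDrops
  congr! with ω s
  have hfin : ∀ i, (s.graph.neighborSet i).Finite := fun i =>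
    Set.finite_of_encard_le_coe (s.degree_le i)
  have hdrop : ∀ t i ξ, |mdl.drops s.graph s.mark (fun k => mdl.rate (m k ω))
      (mdl.mfcRule π L fun k => m k ω) ξ t i| ≤ C := fun t i ξ =>
    hC _ s.degree_le _ (fun k => m k ω) _ ξ t i
  have hmeas := fun t i => mdl.measurable_drops s.mark (fun k => mdl.rate (m k ω))
      (mdl.mfcRule π L fun k => m k ω) hfin t i
  have hsize : (0 : ℝ) < s.size := by exact_mod_cast s.size_pos
  rw [integral_tsum_discounted (C := C) _ mdl.discount_nonneg mdl.discount_lt_one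
    (fun t => (Finset.measurable_sum _ fun i _ => hmeas t i).div_const _)]
  · rw [← Summable.tsum_finsetSum, ← tsum_div_const]
    · refine tsum_congr fun t => ?_
      rw [integral_div, integral_finsetSum, ← Finset.mul_sum, mul_div_assoc]
      · simp only [← mdl.meanDrops_component]
        rfl
      · exact fun i _ => Integrable.of_bound (hmeas t i).aestronglyMeasurable C
          (ae_of_all _ (hdrop t i))
    · exact fun i _ => Summable.of_norm_bounded (mdl.summable_discounted C') fun t =>
        mdl.norm_discounted_le t (hC' _ (s.component i).degree_le _ (fun k => m k ω) _ t _)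
  · intro t ξ
    rw [abs_div, abs_of_pos hsize, div_le_iff₀ hsize]
    refine (Finset.abs_sum_le_sum_abs _ _).trans ?_
    refine (Finset.sum_le_card_nsmul _ _ C fun i _ => hdrop t i ξ).trans ?_
    simp [mul_comm]

theorem Model.exists_discountedDrops_bound [Finite M] : ∃ C, ∀ p g,
    |mdl.discountedDrops π L p g| ≤ C := by
  obtain ⟨C, -, hC⟩ := mdl.exists_meanDrops_bound d
  exact ⟨_, fun p g => tsum_of_norm_bounded (mdl.summable_discounted C).hasSum fun t =>
    mdl.norm_discounted_le t (hC _ g.degree_le _ p _ t _)⟩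

theorem Model.continuous_discountedDrops [Finite M] (p : ℕ → M) :
    Continuous (mdl.discountedDrops π L p) := by
  obtain ⟨C, -, hC⟩ := mdl.exists_meanDrops_bound d
  refine continuous_tsum (fun t => ?_) (mdl.summable_discounted C) fun t g =>
    mdl.norm_discounted_le t (hC _ g.degree_le _ p _ t _)
  exact MarkedRootedGraph.continuous_of_ballIso (2 * t + 2) fun g h hgh => by
    rw [mdl.meanDrops_eq_of_ballIso _ _ t hgh]

/-- Each summand is exact once `T ≥ t`, by causality. This serves measurability in the modulating
path. -/
theorem Model.tendsto_discountedDrops_stopped [Finite M] (p : ℕ → M)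
    (g : MarkedRootedGraph d mdl.buffer) :
    Tendsto (fun T => mdl.discountedDrops π L (fun k => p (min k T)) g) atTop
      (𝓝 (mdl.discountedDrops π L p g)) := by
  obtain ⟨C, -, hC⟩ := mdl.exists_meanDrops_bound d
  refine tendsto_tsum_of_dominated_convergence (mdl.summable_discounted C) (fun t => ?_)
    (Eventually.of_forall fun T t =>
      mdl.norm_discounted_le t (hC _ g.degree_le _ (fun k => p (min k T)) _ t _))
  refine tendsto_const_nhds.congr' ((eventually_ge_atTop t).mono fun T hT => ?_)
  have hp : ∀ s ≤ t, p s = p (min s T) := fun s hs => by rw [min_eq_left (by omega)]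
  rw [mdl.meanDrops_congr g.graph g.mark t g.root (fun s hs => congrArg mdl.rate (hp s hs))
    fun s hs => mdl.mfcRule_congr π L s fun k hk => hp k (hk.trans hs)]

end

/-- Policies are arbitrary functions, so measurability is not inherited from them. A path stopped at
`T` takes finitely many values, so any function of it is measurable, and `Ψ` is a pointwise limit of
such functions. -/
theorem Model.IsModulatingChain.measurable_comp [Finite M] {mdl : Model M} {Ω : Type*}
    [MeasurableSpace Ω] {P : Measure Ω} {m : ℕ → Ω → M} (hm : mdl.IsModulatingChain P m)
    {Ψ : (ℕ → M) → ℝ}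
    (hΨ : ∀ p, Tendsto (fun T => Ψ fun k => p (min k T)) atTop (𝓝 (Ψ p))) :
    Measurable fun ω => Ψ fun k => m k ω := by
  refine measurable_of_tendsto_metrizable (f := fun T ω => Ψ fun k => m (min k T) ω) (fun T => ?_)
    (tendsto_pi_nhds.2 fun ω => hΨ fun k => m k ω)
  let _ : MeasurableSpace M := ⊤
  have hmeas : ∀ k, Measurable (m k) := fun k =>
    measurable_to_countable' fun x => hm.measurableSet_eq k x
  have hpath : Measurable fun ω (k : Fin (T + 1)) => m k ω := measurable_pi_lambda _ fun k => hmeas k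
  exact (measurable_of_countable fun q : Fin (T + 1) → M =>
    Ψ fun k => q ⟨min k T, by omega⟩).comp hpath

/-! ### Convergence of the objectives -/

theorem FiniteSystem.abs_average_le {B : ℕ} (s : FiniteSystem d B)
    {f : MarkedRootedGraph d B → ℝ} {C : ℝ} (hf : ∀ g, |f g| ≤ C) : |s.average f| ≤ C := by
  have hsize : (0 : ℝ) < s.size := by exact_mod_cast s.size_pos
  unfold average
  rw [abs_div, abs_of_pos hsize, div_le_iff₀ hsize]
  refine (Finset.abs_sum_le_sum_abs _ _).trans ?_
  refine (Finset.sum_le_card_nsmul _ _ C fun i _ => hf _).trans ?_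
  simp [mul_comm]

/-- The deviation is below `ε / 2` off the bad event and at most `C + |c|` on it, whose probability
vanishes. -/
theorem tendsto_integral_of_tendsto_measure {X : Type*} [MeasurableSpace X] {μ : ℕ → Measure X}
    [∀ n, IsProbabilityMeasure (μ n)] {f : X → ℝ} (hf : Measurable f) {C c : ℝ}
    (hC : ∀ x, |f x| ≤ C)
    (h : ∀ ε : ℝ, 0 < ε → Tendsto (fun n => μ n {x | ε ≤ |f x - c|}) atTop (𝓝 0)) :
    Tendsto (fun n => ∫ x, f x ∂μ n) atTop (𝓝 c) := by
  rw [Metric.tendsto_atTop']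
  intro ε hε
  have hA : MeasurableSet {x | ε / 2 ≤ |f x - c|} :=
    measurableSet_le measurable_const (hf.sub_const c).abs
  have hreal : Tendsto (fun n => (C + |c|) * (μ n).real {x | ε / 2 ≤ |f x - c|}) atTop (𝓝 0) := by
    have := (ENNReal.tendsto_toReal ENNReal.zero_ne_top).comp (h (ε / 2) (half_pos hε))
    simpa [Function.comp_def, Measure.real] using this.const_mul (C + |c|)
  obtain ⟨N, hN⟩ := eventually_atTop.1 (hreal.eventually (gt_mem_nhds (half_pos hε)))
  refine ⟨N, fun n hn => ?_⟩
  have hfi : Integrable f (μ n) :=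
    Integrable.of_bound hf.aestronglyMeasurable C (ae_of_all _ hC)
  have hle : ∀ x, |f x - c| ≤
      ε / 2 + (C + |c|) * ({x | ε / 2 ≤ |f x - c|}.indicator (fun _ => (1 : ℝ)) x) := fun x => by
    by_cases hx : x ∈ {x | ε / 2 ≤ |f x - c|}
    · rw [Set.indicator_of_mem hx, mul_one]
      linarith [abs_sub (f x) c, hC x]
    · rw [Set.indicator_of_notMem hx, mul_zero, add_zero]
      exact (not_le.1 hx).le
  have hi : Integrable (fun x => (C + |c|) *
      ({x | ε / 2 ≤ |f x - c|}.indicator (fun _ => (1 : ℝ)) x)) (μ n) :=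
    ((integrable_const _).indicator hA).const_mul _
  calc dist (∫ x, f x ∂μ n) c = |∫ x, (f x - c) ∂μ n| := by
        rw [integral_sub hfi (integrable_const _)]
        simp [Real.dist_eq]
    _ ≤ ∫ x, |f x - c| ∂μ n := abs_integral_le_integral_abs
    _ ≤ ∫ x, (ε / 2 + (C + |c|) * ({x | ε / 2 ≤ |f x - c|}.indicator (fun _ => (1 : ℝ)) x)) ∂μ n :=
        integral_mono (hfi.sub (integrable_const c)).abs ((integrable_const _).add hi) hle
    _ = ε / 2 + (C + |c|) * (μ n).real {x | ε / 2 ≤ |f x - c|} := by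
        rw [integral_add (integrable_const _) hi, integral_const_mul, integral_indicator_const _ hA]
        simp
    _ < ε := by linarith [hN n hn.le]

theorem Model.tendsto_finiteObjective [Finite M] {Ω : Type*} [MeasurableSpace Ω] (P : Measure Ω)
    [IsProbabilityMeasure P] (m : ℕ → Ω → M) (hm : mdl.IsModulatingChain P m)
    (μ : ℕ → Measure (FiniteSystem d mdl.buffer)) [∀ n, IsProbabilityMeasure (μ n)]
    (L : Measure (MarkedRootedGraph d mdl.buffer))
    (hconv : ConvergesLocallyWeakly μ L) (π : MFCPolicy M d mdl.buffer) :
    Tendsto (fun n => mdl.finiteObjective P m L (μ n) π) atTop (𝓝 (mdl.mfcObjective P m L π)) := by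
  obtain ⟨C, hC⟩ := mdl.exists_discountedDrops_bound π L
  simp only [mdl.finiteObjective_eq, mdl.mfcObjective_eq]
  refine (tendsto_integral_of_dominated_convergence (fun _ => C) (fun n => ?_) (integrable_const _)
    (fun n => ae_of_all _ fun ω => ?_) (ae_of_all _ fun ω => ?_)).neg
  -- Measurability in `ω`: stopped paths are passed through the finite average and then through the
  -- integral over `s`.
  · refine (hm.measurable_comp (Ψ := fun p => ∫ s, s.average (mdl.discountedDrops π L p) ∂μ n)
      fun p => ?_).aestronglyMeasurable
    refine tendsto_integral_of_dominated_convergence (fun _ => C)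
      (fun T => measurable_from_top.aestronglyMeasurable) (integrable_const _)
      (fun T => ae_of_all _ fun s => s.abs_average_le (hC _)) (ae_of_all _ fun s => ?_)
    exact (tendsto_finsetSum _ fun i _ =>
      mdl.tendsto_discountedDrops_stopped π L p (s.component i)).div_const _
  · simpa using norm_integral_le_of_norm_le_const (μ := μ n)
      (f := fun s => s.average (mdl.discountedDrops π L fun k => m k ω))
      (ae_of_all _ fun s => s.abs_average_le (hC fun k => m k ω))
  · refine tendsto_integral_of_tendsto_measure measurable_from_top
      (fun s => s.abs_average_le (hC fun k => m k ω)) fun ε hε => ?_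
    exact hconv (BoundedContinuousFunction.ofNormedAddCommGroup _
      (mdl.continuous_discountedDrops π L fun k => m k ω) C (hC fun k => m k ω)) ε hε

end SparseQueue

end

theorem corollary2p2 {M : Type*} [Finite M] (mdl : SparseQueue.Model M) (d : ℕ)
    {Ω : Type*} [MeasurableSpace Ω] (P : Measure Ω) [IsProbabilityMeasure P]
    (m : ℕ → Ω → M) (hm : mdl.IsModulatingChain P m)
    (μ : ℕ → Measure (SparseQueue.FiniteSystem d mdl.buffer))
    [∀ n, IsProbabilityMeasure (μ n)]
    (L : Measure (SparseQueue.MarkedRootedGraph d mdl.buffer)) [IsProbabilityMeasure L]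
    (hconv : SparseQueue.ConvergesLocallyWeakly μ L)
    {K : ℕ} (π : Fin K → SparseQueue.MFCPolicy M d mdl.buffer)
    (hdist : Function.Injective fun j => mdl.mfcObjective P m L (π j))
    (i : Fin K) (hi : ∀ j, mdl.mfcObjective P m L (π j) ≤ mdl.mfcObjective P m L (π i)) :
    ∃ n' : ℕ, ∀ n > n', ∀ j,
      mdl.finiteObjective P m L (μ n) (π j) ≤ mdl.finiteObjective P m L (μ n) (π i) := by
  have hlim := fun j => mdl.tendsto_finiteObjective P m hm μ L hconv (π j)
  have hev : ∀ᶠ n in atTop, ∀ j,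
      mdl.finiteObjective P m L (μ n) (π j) ≤ mdl.finiteObjective P m L (μ n) (π i) := by
    refine eventually_all.2 fun j => ?_
    rcases eq_or_ne j i with rfl | hji
    · exact Eventually.of_forall fun _ => le_rfl
    -- Distinctness makes the gap strict; with a tie in the limit, the finite objectives could be
    -- ordered either way.
    · have hlt := lt_of_le_of_ne (hi j) fun h => hji (hdist h)
      exact ((hlim j).eventually_lt (hlim i) hlt).mono fun _ h => h.le
  obtain ⟨N, hN⟩ := eventually_atTop.1 hev
  exact ⟨N, fun n hn => hN n hn.le⟩
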